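/- Let $d\ge 2$ be an integer and $\lambda\ge 0$ a real number. A \emph{generator} matrix is a matrix $Q\in\mathbb{R}^{d\times d}$ with $Q_{ij}\ge 0$ for all $i\ne j$ and $Q\mathbf{1}=0$; a \emph{subgenerator} matrix is one with $Q_{ij}\ge 0$ for all $i\ne j$ and $Q\mathbf{1}\le 0$ entrywise, where $\mathbf 1$ is the vector of all ones. The number $\lambda$ is a \emph{uniformization rate} for $Q$ if $\lambda\ge |Q_{ii}|$ for all $i$. The \emph{field of values} of $A\in\mathbb{C}^{d\times d}$ is $\mathbb{W}(A)=\{\mathbf{x}^*A\mathbf{x} : \mathbf{x}\in\mathbb{C}^d,\ \|\mathbf{x}\|_2=1\}$. Here a rectangle is a closed (possibly degenerate) rectangle $[a,b]+i[c,e]$, $a\le b$, $c\le e$, in the complex plane with sides parallel to the axes. The smallest rectangle $\Omega$, with respect to inclusion, such that $\mathbb{W}(Q)\subseteq\Omega$ for each generator or subgenerator matrix $Q\in\mathbb{R}^{d\times d}$ with uniformization rate $\lambda$ exists and is \[ \Omega_d=\begin{cases} \left[-2\lambda,\ \frac{\lambda}{2}(\sqrt2-1)\right]+i\left[-\frac12\lambda,\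 \frac12\lambda\right], & d=2;\\[1ex] \left[-\left(1+\frac{\sqrt5}{2}\right)\lambda,\ \frac{\lambda}{2}(\sqrt3-1)\right]+i\left[-\frac{\sqrt3}{2}\lambda,\ \frac{\sqrt3}{2}\lambda\right], & d=3;\\[1ex] \left[-\left(1+\frac{\sqrt6}{2}\right)\lambda,\ \frac{\lambda}{2}\right]+i\left[-\lambda,\ \lambda\right], & d=4;\\[1ex] \left[-\left(1+\frac{\sqrt{d+2}}{2}\right)\lambda,\ \frac{\lambda}{2}(\sqrt d-1)\right]+i\left[-\frac{\sqrt2\,\lambda}{4}\sqrt{d+\sqrt{d^2-4d+12}},\ \frac{\sqrt2\,\lambda}{4}\sqrt{d+\sqrt{d^2-4d+12}}\right], & d\ge5. \end{cases} \] -/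

import Mathlib

/-- The field of values (numerical range) `W(A) = {x* A x : x ∈ ℂᵈ, ‖x‖ = 1}`, with the Euclidean
norm on `ℂᵈ`. -/
def fieldOfValues {d : ℕ} (A : Matrix (Fin d) (Fin d) ℂ) : Set ℂ :=
  {z : ℂ | ∃ x : EuclideanSpace ℂ (Fin d), ‖x‖ = 1 ∧
    z = ∑ i, ∑ j, (starRingEnd ℂ) (x i) * A i j * x j}

/-- Generator matrix of a continuous-time Markov chain: nonnegative off-diagonal entries and zero
row sums. -/
def IsGenerator {d : ℕ} (Q : Matrix (Fin d) (Fin d) ℝ) : Prop :=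
  (∀ i j, i ≠ j → 0 ≤ Q i j) ∧ ∀ i, ∑ j, Q i j = 0

/-- Subgenerator matrix: nonnegative off-diagonal entries and nonpositive row sums. -/
def IsSubgenerator {d : ℕ} (Q : Matrix (Fin d) (Fin d) ℝ) : Prop :=
  (∀ i j, i ≠ j → 0 ≤ Q i j) ∧ ∀ i, ∑ j, Q i j ≤ 0

/-- `lam` is a uniformization rate for `Q`: it bounds all absolute values of diagonal entries. -/
def IsUniformizationRate {d : ℕ} (Q : Matrix (Fin d) (Fin d) ℝ) (lam : ℝ) : Prop :=
  ∀ i, |Q i i| ≤ lam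

/-- Closed, possibly degenerate, rectangles in `ℂ` with sides parallel to the axes. -/
def IsAxisRectangle (R : Set ℂ) : Prop :=
  ∃ a b c e : ℝ, a ≤ b ∧ c ≤ e ∧ R = {z : ℂ | z.re ∈ Set.Icc a b ∧ z.im ∈ Set.Icc c e}

/-- The rectangle `Ω_d`, as the product of its real and imaginary intervals, case by case.
The last case is meant for `5 ≤ d`. -/
noncomputable def rectangleOmega (d : ℕ) (lam : ℝ) : Set ℂ :=
  if d = 2 then
    {z : ℂ | z.re ∈ Set.Icc (-2 * lam) (lam / 2 * (√2 - 1)) ∧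
      z.im ∈ Set.Icc (-(1 / 2 * lam)) (1 / 2 * lam)}
  else if d = 3 then
    {z : ℂ | z.re ∈ Set.Icc (-(1 + √5 / 2) * lam) (lam / 2 * (√3 - 1)) ∧
      z.im ∈ Set.Icc (-(√3 / 2 * lam)) (√3 / 2 * lam)}
  else if d = 4 then
    {z : ℂ | z.re ∈ Set.Icc (-(1 + √6 / 2) * lam) (lam / 2) ∧
      z.im ∈ Set.Icc (-lam) lam}
  else
    {z : ℂ | z.re ∈ Set.Icc (-(1 + √((d : ℝ) + 2) / 2) * lam) (lam / 2 * (√(d : ℝ) - 1)) ∧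
      z.im ∈ Set.Icc
        (-(√2 * lam / 4 * √((d : ℝ) + √((d : ℝ) ^ 2 - 4 * (d : ℝ) + 12))))
        (√2 * lam / 4 * √((d : ℝ) + √((d : ℝ) ^ 2 - 4 * (d : ℝ) + 12)))}

/-! An element of `W(Q)` is `∑ i, ∑ j, Q i j * conj (x i) * x j`, linear in each row of `Q`. For
fixed `λ`, an admissible row is a convex combination of `0`, `-λ eᵢ` and `λ (eⱼ - eᵢ)`, so bounds
can be taken row by row (`IsSubgenerator.row_le`), and the extremal matrices are functional digraphs
`i ↦ f i` with all rates `λ`.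

Each side is then an eigenvalue bound for a small weighted graph, proved by AM-GM with the
eigenvalue as weight. On the right every state jumps to the coordinate of largest modulus: a star
(`sum_mul_max_le`). On the left each jumps to the extreme coordinate of opposite sign: a double star
(`sum_opposite_sign_le`). For the imaginary part, the orbit of the largest coordinate is followed
for three steps and the other edges become pendant there, leaving a star, a triangle or a 4-cycle
(`functional_im_le`). The 4-cycle wins at `d = 4`, the triangle at `d = 3` and `d ≥ 5`. Equality
vectors show sharpness. -/

open Finset in
/-- Elements of the field of values in terms of the real quadratic coefficients. -/
lemma re_form {d : ℕ} (Q : Matrix (Fin d) (Fin d) ℝ) (x : Fin d → ℂ) :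
    (∑ i, ∑ j, (starRingEnd ℂ) (x i) * (Q.map (fun r : ℝ => (r : ℂ))) i j * x j).re =
      ∑ i, ∑ j, Q i j * ((starRingEnd ℂ) (x i) * x j).re := by
  simp only [Complex.re_sum, Matrix.map_apply]
  refine sum_congr rfl fun i _ => sum_congr rfl fun j _ => ?_
  simp
  ring

open Finset in
lemma im_form {d : ℕ} (Q : Matrix (Fin d) (Fin d) ℝ) (x : Fin d → ℂ) :
    (∑ i, ∑ j, (starRingEnd ℂ) (x i) * (Q.map (fun r : ℝ => (r : ℂ))) i j * x j).im =
      ∑ i, ∑ j, Q i j * ((starRingEnd ℂ) (x i) * x j).im := by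
  simp only [Complex.im_sum, Matrix.map_apply]
  refine sum_congr rfl fun i _ => sum_congr rfl fun j _ => ?_
  simp
  ring

lemma IsGenerator.isSubgenerator {d : ℕ} {Q : Matrix (Fin d) (Fin d) ℝ} (h : IsGenerator Q) :
    IsSubgenerator Q :=
  ⟨h.1, fun i => (h.2 i).le⟩

open Finset in
/-- A row of a subgenerator, paired with `g`, is at most `lam` times any common bound for the
increments `g j - g i` and for `-g i`. -/
lemma IsSubgenerator.row_le {d : ℕ} {Q : Matrix (Fin d) (Fin d) ℝ} (hQ : IsSubgenerator Q)
    {lam : ℝ} (hr : IsUniformizationRate Q lam) (i : Fin d) (g : Fin d → ℝ) (G : ℝ)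
    (hG : 0 ≤ G) (h1 : ∀ j, g j - g i ≤ G) (h2 : -g i ≤ G) :
    ∑ j, Q i j * g j ≤ lam * G := by
  have e1 : ∑ j, Q i j * g j = ∑ j, Q i j * (g j - g i) + (∑ j, Q i j) * g i := by
    rw [sum_mul, ← sum_add_distrib]
    exact sum_congr rfl fun j _ => by ring
  have e2 : ∑ j, Q i j * (g j - g i) = ∑ j ∈ univ.erase i, Q i j * (g j - g i) := by
    rw [← add_sum_erase univ _ (mem_univ i)]
    simp
  have e3 : ∑ j ∈ univ.erase i, Q i j * (g j - g i) ≤ ∑ j ∈ univ.erase i, Q i j * G :=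
    sum_le_sum fun j hj =>
      mul_le_mul_of_nonneg_left (h1 j) (hQ.1 i j (ne_of_mem_erase hj).symm)
  have e4 : ∑ j, Q i j = Q i i + ∑ j ∈ univ.erase i, Q i j :=
    (add_sum_erase univ _ (mem_univ i)).symm
  rw [← sum_mul] at e3
  have e5 := hQ.2 i
  have e6 : -Q i i ≤ lam := (neg_le_abs _).trans (hr i)
  -- A row deficit acts as a jump to a cemetery where `g` is `0`, with increment `-g i ≤ G`.
  nlinarith [mul_le_mul_of_nonneg_right e6 hG, mul_nonneg (neg_nonneg.2 e5) (sub_nonneg.2 h2)]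

open Finset in
lemma sum_mul_le_card {ι : Type*} (s : Finset ι) (r : ι → ℝ) (M κ : ℝ) (hκ : 0 < κ) :
    ∑ i ∈ s, M * r i ≤ #s * (M ^ 2 / (2 * κ)) + κ / 2 * ∑ i ∈ s, r i ^ 2 := by
  rw [mul_sum, ← nsmul_eq_mul, ← sum_const, ← sum_add_distrib]
  refine sum_le_sum fun i _ => ?_
  have : M ^ 2 / (2 * κ) + κ / 2 * r i ^ 2 - M * r i = (M - κ * r i) ^ 2 / (2 * κ) := by
    field_simp
    ring
  have h2 : 0 ≤ (M - κ * r i) ^ 2 / (2 * κ) := by positivity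
  linarith

open Finset in
/-- The estimate behind the right end of the real interval. -/
lemma sum_mul_max_le {d : ℕ} (r : Fin d → ℝ) (a : Fin d) :
    ∑ i, r a * r i ≤ (1 + √(d : ℝ)) / 2 * ∑ i, r i ^ 2 := by
  have hs : 0 ≤ √(d : ℝ) := Real.sqrt_nonneg _
  have hss : √(d : ℝ) ^ 2 = d := Real.sq_sqrt (Nat.cast_nonneg d)
  have hd : 1 ≤ d := a.pos
  -- Since `d - 1 = (√d - 1)(√d + 1)`, this weight makes the coefficients of `r a ^ 2` balance.
  have h := sum_mul_le_card (univ.erase a) r (r a) (1 + √(d : ℝ)) (by positivity)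
  rw [card_erase_of_mem (mem_univ a), card_univ, Fintype.card_fin, Nat.cast_sub hd,
    Nat.cast_one] at h
  rw [← add_sum_erase univ _ (mem_univ a),
    ← add_sum_erase univ (fun i => r i ^ 2) (mem_univ a)]
  have h2 : ((d : ℝ) - 1) * (r a ^ 2 / (2 * (1 + √(d : ℝ)))) = (√(d : ℝ) - 1) / 2 * r a ^ 2 := by
    have h3 : (d : ℝ) - 1 = (√(d : ℝ) - 1) * (1 + √(d : ℝ)) := by linarith
    rw [h3]
    field_simp
  nlinarith

open Finset in
/-- The estimate behind the left end of the real interval. -/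
lemma sum_opposite_sign_le {d : ℕ} (u : Fin d → ℝ) (a b : Fin d)
    (hpos : 0 < u a) (hneg : u b < 0) :
    ∑ i, (if 0 ≤ u i then u i * (-u b) else (-u i) * u a) ≤
      √((d : ℝ) + 2) / 2 * ∑ i, u i ^ 2 := by
  set s := √((d : ℝ) + 2) with hs
  have hs0 : 0 < s := Real.sqrt_pos.2 (by positivity)
  have hss : s ^ 2 = (d : ℝ) + 2 := Real.sq_sqrt (by positivity)
  have hab : b ≠ a := by rintro rfl; linarith
  have hbm : b ∈ univ.erase a := mem_erase.2 ⟨hab, mem_univ b⟩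
  set t := (univ.erase a).erase b with ht
  have hcard : (#t : ℝ) + 2 = d := by
    have h1 : #t + 1 = #(univ.erase a) := card_erase_add_one hbm
    have h2 : #(univ.erase a) + 1 = #(univ : Finset (Fin d)) := card_erase_add_one (mem_univ a)
    rw [card_univ, Fintype.card_fin] at h2
    have : #t + 2 = d := by omega
    exact_mod_cast this
  have split : ∀ g : Fin d → ℝ, ∑ i, g i = g a + (g b + ∑ i ∈ t, g i) := fun g => by
    rw [← add_sum_erase univ _ (mem_univ a), ← add_sum_erase _ _ hbm]
  set p := t.filter (fun i => 0 ≤ u i)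
  set n := t.filter (fun i => ¬ 0 ≤ u i)
  have hpn : (#p : ℝ) + #n = #t := by exact_mod_cast card_filter_add_card_filter_not _
  have hp := sum_mul_le_card p u (-u b) s hs0
  have hn := sum_mul_le_card n u (-u a) s hs0
  have hsplit2 : ∑ i ∈ t, u i ^ 2 = ∑ i ∈ p, u i ^ 2 + ∑ i ∈ n, u i ^ 2 :=
    (sum_filter_add_sum_filter_not _ _ _).symm
  rw [split, split (fun i => u i ^ 2), sum_ite, if_pos hpos.le, if_neg hneg.not_ge, hsplit2]
  have e1 : ∑ i ∈ p, u i * (-u b) = ∑ i ∈ p, (-u b) * u i := sum_congr rfl fun i _ => mul_comm _ _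
  have e2 : ∑ i ∈ n, (-u i) * u a = ∑ i ∈ n, (-u a) * u i := sum_congr rfl fun i _ => by ring
  rw [e1, e2]
  have hk : (0 : ℝ) ≤ #p := Nat.cast_nonneg _
  have hl : (0 : ℝ) ≤ #n := Nat.cast_nonneg _
  generalize (#p : ℝ) = k at *
  generalize (#n : ℝ) = l at *
  -- Discriminant condition: `k + l + 4 = s ^ 2`, so `(l + 4)(k + 4) = l k + 4 s ^ 2`.
  have key : 4 * s * (u a * (-u b)) ≤ (l + 4) * (-u b) ^ 2 + (k + 4) * u a ^ 2 := by
    have h4 : (2 * s) ^ 2 ≤ (l + 4) * (k + 4) := by nlinarith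
    have h5 : 0 < l + 4 := by linarith
    have h6 : 0 ≤ ((l + 4) * (-u b) - 2 * s * u a) ^ 2 := sq_nonneg _
    have h7 : (2 * s) ^ 2 * u a ^ 2 ≤ (l + 4) * (k + 4) * u a ^ 2 :=
      mul_le_mul_of_nonneg_right h4 (sq_nonneg _)
    have h8 : 0 ≤ (l + 4) * ((l + 4) * (-u b) ^ 2 + (k + 4) * u a ^ 2
        - 4 * s * (u a * (-u b))) := by nlinarith
    linarith [nonneg_of_mul_nonneg_right h8 h5]
  have fin : k * ((-u b) ^ 2 / (2 * s)) + l * ((-u a) ^ 2 / (2 * s)) + 2 * (u a * (-u b)) ≤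
      s / 2 * (u a ^ 2 + u b ^ 2) := by
    have h9 : s / 2 * (u a ^ 2 + u b ^ 2) - (k * ((-u b) ^ 2 / (2 * s))
        + l * ((-u a) ^ 2 / (2 * s)) + 2 * (u a * (-u b))) =
        ((l + 4) * (-u b) ^ 2 + (k + 4) * u a ^ 2 - 4 * s * (u a * (-u b))) / (2 * s) := by
      have hl4 : l + 4 = s ^ 2 - k := by linarith
      have hk4 : k + 4 = s ^ 2 - l := by linarith
      rw [hl4, hk4]
      field_simp
      ring
    have h10 : 0 ≤ ((l + 4) * (-u b) ^ 2 + (k + 4) * u a ^ 2 - 4 * s * (u a * (-u b))) / (2 * s) :=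
      div_nonneg (by linarith) (by linarith)
    linarith
  nlinarith

/-! ### Bounds for the real part. -/

lemma IsSubgenerator.re_le {d : ℕ} {Q : Matrix (Fin d) (Fin d) ℝ} (hQ : IsSubgenerator Q)
    {lam : ℝ} (hr : IsUniformizationRate Q lam) (hlam : 0 ≤ lam) (x : Fin d → ℂ) :
    ∑ i, ∑ j, Q i j * ((starRingEnd ℂ) (x i) * x j).re ≤
      lam / 2 * (√(d : ℝ) - 1) * ∑ i, ‖x i‖ ^ 2 := by
  rcases isEmpty_or_nonempty (Fin d) with h | h
  · simp
  obtain ⟨a, ha⟩ := Finite.exists_max fun i => ‖x i‖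
  have hrow : ∀ i, ∑ j, Q i j * ((starRingEnd ℂ) (x i) * x j).re ≤
      lam * (‖x a‖ * ‖x i‖ - ‖x i‖ ^ 2) := by
    intro i
    have hself : ((starRingEnd ℂ) (x i) * x i).re = ‖x i‖ ^ 2 := by
      rw [mul_comm, Complex.mul_conj, Complex.ofReal_re, Complex.normSq_eq_norm_sq]
    refine hQ.row_le hr i _ _ ?_ (fun j => ?_) ?_
    · nlinarith [ha i, norm_nonneg (x i)]
    · rw [hself]
      have h1 : ((starRingEnd ℂ) (x i) * x j).re ≤ ‖x i‖ * ‖x j‖ := by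
        simpa using Complex.re_le_norm ((starRingEnd ℂ) (x i) * x j)
      nlinarith [ha j, norm_nonneg (x i)]
    · rw [hself]
      nlinarith [ha i, norm_nonneg (x i), norm_nonneg (x a)]
  refine (Finset.sum_le_sum fun i _ => hrow i).trans ?_
  rw [← Finset.mul_sum, Finset.sum_sub_distrib]
  have := mul_le_mul_of_nonneg_left (sum_mul_max_le (fun i => ‖x i‖) a) hlam
  linarith

lemma IsSubgenerator.neg_le_quadratic {d : ℕ} {Q : Matrix (Fin d) (Fin d) ℝ}
    (hQ : IsSubgenerator Q) {lam : ℝ} (hr : IsUniformizationRate Q lam) (hlam : 0 ≤ lam)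
    (u : Fin d → ℝ) :
    -((1 + √((d : ℝ) + 2) / 2) * lam) * ∑ i, u i ^ 2 ≤ ∑ i, ∑ j, Q i j * (u i * u j) := by
  rcases isEmpty_or_nonempty (Fin d) with h | h
  · simp
  obtain ⟨a, ha⟩ := Finite.exists_max u
  obtain ⟨b, hb⟩ := Finite.exists_min u
  have hnn : 0 ≤ √((d : ℝ) + 2) / 2 * ∑ i, u i ^ 2 :=
    mul_nonneg (by positivity) (Finset.sum_nonneg fun i _ => sq_nonneg _)
  -- `w i` bounds the gain of the best jump from `i`; it can be `0` if all coordinates of `u` have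
  -- one sign.
  suffices H : ∃ w : Fin d → ℝ, (∀ i, 0 ≤ w i) ∧ (∀ i j, -(u i * u j) ≤ w i) ∧
      ∑ i, w i ≤ √((d : ℝ) + 2) / 2 * ∑ i, u i ^ 2 by
    obtain ⟨w, hw0, hw, hsum⟩ := H
    have hrow : ∀ i, ∑ j, Q i j * -(u i * u j) ≤ lam * (u i ^ 2 + w i) := by
      intro i
      refine hQ.row_le hr i _ _ ?_ (fun j => ?_) ?_
      · nlinarith [hw0 i, sq_nonneg (u i)]
      · nlinarith [hw i j]
      · nlinarith [hw0 i]
    have h1 := Finset.sum_le_sum fun i (_ : i ∈ Finset.univ) => hrow i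
    rw [← Finset.mul_sum, Finset.sum_add_distrib] at h1
    simp only [mul_neg, Finset.sum_neg_distrib] at h1
    nlinarith [mul_le_mul_of_nonneg_left hsum hlam]
  by_cases hpos : 0 < u a
  · by_cases hneg : u b < 0
    · refine ⟨_, fun i => ?_, fun i j => ?_, sum_opposite_sign_le u a b hpos hneg⟩
      · split_ifs with h0
        · nlinarith
        · nlinarith
      · split_ifs with h0
        · nlinarith [hb j]
        · nlinarith [ha j]
    · refine ⟨fun _ => 0, fun _ => le_rfl, fun i j => ?_, by simpa using hnn⟩
      have h1 : 0 ≤ u i := by linarith [hb i]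
      have h2 : 0 ≤ u j := by linarith [hb j]
      nlinarith
  · refine ⟨fun _ => 0, fun _ => le_rfl, fun i j => ?_, by simpa using hnn⟩
    have h1 : u i ≤ 0 := by linarith [ha i]
    have h2 : u j ≤ 0 := by linarith [ha j]
    nlinarith

/-- As `Q` is real, the real part splits into the quadratic forms of `Re x` and `Im x`. -/
lemma IsSubgenerator.le_re {d : ℕ} {Q : Matrix (Fin d) (Fin d) ℝ} (hQ : IsSubgenerator Q)
    {lam : ℝ} (hr : IsUniformizationRate Q lam) (hlam : 0 ≤ lam) (x : Fin d → ℂ) :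
    -((1 + √((d : ℝ) + 2) / 2) * lam) * ∑ i, ‖x i‖ ^ 2 ≤
      ∑ i, ∑ j, Q i j * ((starRingEnd ℂ) (x i) * x j).re := by
  have h1 := hQ.neg_le_quadratic hr hlam fun i => (x i).re
  have h2 := hQ.neg_le_quadratic hr hlam fun i => (x i).im
  have e1 : ∑ i, ‖x i‖ ^ 2 = ∑ i, (x i).re ^ 2 + ∑ i, (x i).im ^ 2 := by
    rw [← Finset.sum_add_distrib]
    refine Finset.sum_congr rfl fun i _ => ?_
    rw [← Complex.normSq_eq_norm_sq, Complex.normSq_apply]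
    ring
  have e2 : ∑ i, ∑ j, Q i j * ((starRingEnd ℂ) (x i) * x j).re =
      ∑ i, ∑ j, Q i j * ((x i).re * (x j).re) + ∑ i, ∑ j, Q i j * ((x i).im * (x j).im) := by
    rw [← Finset.sum_add_distrib]
    refine Finset.sum_congr rfl fun i _ => ?_
    rw [← Finset.sum_add_distrib]
    refine Finset.sum_congr rfl fun j _ => ?_
    simp
    ring
  rw [e1, e2, mul_add]
  exact add_le_add h1 h2

/-! ### Bounds for the imaginary part. -/

lemma im_conj_mul_le (z w : ℂ) : ((starRingEnd ℂ) z * w).im ≤ ‖z‖ * ‖w‖ := by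
  simpa using Complex.im_le_norm ((starRingEnd ℂ) z * w)

lemma im_conj_mul_swap (z w : ℂ) :
    ((starRingEnd ℂ) z * w).im + ((starRingEnd ℂ) w * z).im = 0 := by
  simp
  ring

lemma im_conj_mul_self (z : ℂ) : ((starRingEnd ℂ) z * z).im = 0 := by
  simp
  ring

/-- Directed triangle with `m` pendant edges at `a`. -/
lemma triangle_bound (a b c : ℂ) (m μ : ℝ) (hμ : 0 < μ) (h2 : 1 < μ ^ 2)
    (h3 : 0 ≤ μ ^ 4 - (m + 3) * μ ^ 2 + m) :
    ((starRingEnd ℂ) a * b).im + ((starRingEnd ℂ) b * c).im + ((starRingEnd ℂ) c * a).im +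
      m * (‖a‖ ^ 2 / (2 * μ)) ≤ μ / 2 * (‖a‖ ^ 2 + ‖b‖ ^ 2 + ‖c‖ ^ 2) := by
  simp only [← Complex.normSq_eq_norm_sq, Complex.normSq_apply, Complex.mul_im, Complex.conj_re,
    Complex.conj_im]
  obtain ⟨p, q⟩ := a
  obtain ⟨r, s⟩ := b
  obtain ⟨v, w⟩ := c
  simp only
  -- `F` is what remains after completing the square in `b`; completing it in `c` then leaves the
  -- quartic of `h3` times `‖a‖ ^ 2`.
  set F := (μ ^ 2 - m - 1) * (p * p + q * q) + (μ ^ 2 - 1) * (v * v + w * w)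
    + 2 * (v * p + w * q) - 2 * μ * (v * q - w * p) with hF
  have k1 : 0 ≤ (μ ^ 2 - 1) * F := by
    have e : (μ ^ 2 - 1) * F = ((μ ^ 2 - 1) * v + p - μ * q) ^ 2
        + ((μ ^ 2 - 1) * w + q + μ * p) ^ 2
        + (μ ^ 4 - (m + 3) * μ ^ 2 + m) * (p ^ 2 + q ^ 2) := by
      rw [hF]
      ring
    rw [e]
    positivity
  have k2 : 0 ≤ F := nonneg_of_mul_nonneg_right k1 (by linarith)
  have k3 : μ / 2 * (p * p + q * q + (r * r + s * s) + (v * v + w * w)) -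
      (p * s + -q * r + (r * w + -s * v) + (v * q + -w * p) + m * ((p * p + q * q) / (2 * μ))) =
      (F + ((μ * r + (q - w)) ^ 2 + (μ * s - (p - v)) ^ 2)) / (2 * μ) := by
    rw [hF]
    field_simp
    ring
  have k4 : 0 ≤ (F + ((μ * r + (q - w)) ^ 2 + (μ * s - (p - v)) ^ 2)) / (2 * μ) := by positivity
  linarith

/-- Four-cycle with `m` pendant edges at `a`. -/
lemma square_bound (a b c e m μ : ℝ) (hμ : 0 < μ) (h2 : 2 < μ ^ 2)
    (h3 : 0 ≤ μ ^ 4 - (m + 4) * μ ^ 2 + 2 * m) :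
    a * b + b * c + c * e + e * a + m * (a ^ 2 / (2 * μ)) ≤
      μ / 2 * (a ^ 2 + b ^ 2 + c ^ 2 + e ^ 2) := by
  have k1 : 0 ≤ (μ ^ 2 - 2) * ((μ ^ 2 - 2) * c ^ 2 + (μ ^ 2 - m - 2) * a ^ 2 - 4 * a * c) := by
    nlinarith [sq_nonneg ((μ ^ 2 - 2) * c - 2 * a), mul_nonneg h3 (sq_nonneg a)]
  have k2 : 0 ≤ (μ ^ 2 - 2) * c ^ 2 + (μ ^ 2 - m - 2) * a ^ 2 - 4 * a * c :=
    nonneg_of_mul_nonneg_right k1 (by linarith)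
  have k3 : μ / 2 * (a ^ 2 + b ^ 2 + c ^ 2 + e ^ 2) -
      (a * b + b * c + c * e + e * a + m * (a ^ 2 / (2 * μ))) =
      (((μ ^ 2 - 2) * c ^ 2 + (μ ^ 2 - m - 2) * a ^ 2 - 4 * a * c)
        + ((μ * b - (a + c)) ^ 2 + (μ * e - (a + c)) ^ 2)) / (2 * μ) := by
    field_simp
    ring
  have k4 : 0 ≤ (((μ ^ 2 - 2) * c ^ 2 + (μ ^ 2 - m - 2) * a ^ 2 - 4 * a * c)
        + ((μ * b - (a + c)) ^ 2 + (μ * e - (a + c)) ^ 2)) / (2 * μ) := by positivity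
  linarith

open Finset in
lemma sum_eq_add_erase {d : ℕ} (g : Fin d → ℝ) (a : Fin d) :
    ∑ i, g i = g a + ∑ i ∈ univ.erase a, g i :=
  (add_sum_erase univ _ (mem_univ a)).symm

open Finset in
/-- The skew form of a functional digraph on `Fin d` is bounded by `μ / 2`. -/
lemma functional_im_le {d : ℕ} (x : Fin d → ℂ) (f : Fin d → Fin d) (μ : ℝ) (hμ : 0 < μ)
    (h1 : (d : ℝ) - 1 ≤ μ ^ 2) (h3 : 3 ≤ d → 0 ≤ μ ^ 4 - d * μ ^ 2 + (d - 3))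
    (h4 : 4 ≤ d → 0 ≤ μ ^ 4 - d * μ ^ 2 + 2 * (d - 4)) :
    ∑ i, ((starRingEnd ℂ) (x i) * x (f i)).im ≤ μ / 2 * ∑ i, ‖x i‖ ^ 2 := by
  rcases isEmpty_or_nonempty (Fin d) with h | h
  · simp
  obtain ⟨a, ha⟩ := Finite.exists_max fun i => ‖x i‖
  set g : Fin d → ℝ := fun i => ((starRingEnd ℂ) (x i) * x (f i)).im with hg
  have hgle : ∀ i, g i ≤ ‖x a‖ * ‖x i‖ := fun i =>
    (im_conj_mul_le _ _).trans (by nlinarith [ha (f i), norm_nonneg (x i)])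
  have card1 : ((#(univ.erase a) : ℕ) : ℝ) + 1 = d := by
    have := card_erase_add_one (mem_univ a)
    rw [card_univ, Fintype.card_fin] at this
    exact_mod_cast this
  -- The star with all other vertices pendant at `a`; orbits that stop or backtrack reduce to it,
  -- because loops contribute `0` and 2-cycles cancel.
  have star : ∑ i ∈ univ.erase a, ‖x a‖ * ‖x i‖ ≤ μ / 2 * ∑ i, ‖x i‖ ^ 2 := by
    have hs := sum_mul_le_card (univ.erase a) (fun i => ‖x i‖) ‖x a‖ μ hμ
    rw [sum_eq_add_erase (fun i => ‖x i‖ ^ 2) a]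
    have : (#(univ.erase a) : ℝ) * (‖x a‖ ^ 2 / (2 * μ)) ≤ μ / 2 * ‖x a‖ ^ 2 := by
      have e : μ / 2 * ‖x a‖ ^ 2 = μ ^ 2 * (‖x a‖ ^ 2 / (2 * μ)) := by
        field_simp
      rw [e]
      exact mul_le_mul_of_nonneg_right (by linarith) (by positivity)
    linarith
  have rest : ∀ s : Finset (Fin d), ∑ i ∈ s, g i ≤ ∑ i ∈ s, ‖x a‖ * ‖x i‖ :=
    fun s => sum_le_sum fun i _ => hgle i
  by_cases hba : f a = a
  · have h0 : g a = 0 := by simp only [hg, hba, im_conj_mul_self]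
    rw [sum_eq_add_erase g a, h0, zero_add]
    exact (rest _).trans star
  set b := f a with hb
  have hbm : b ∈ univ.erase a := mem_erase.2 ⟨hba, mem_univ b⟩
  have card2 : (#((univ.erase a).erase b) : ℝ) + 1 = #(univ.erase a) := by
    exact_mod_cast card_erase_add_one hbm
  have hga : g a ≤ ‖x a‖ * ‖x b‖ := im_conj_mul_le _ _
  have nonneg : ∀ i, 0 ≤ ‖x a‖ * ‖x i‖ := fun i => by positivity
  by_cases hcb : f b = b
  · have h0 : g b = 0 := by simp only [hg, hcb, im_conj_mul_self]
    rw [sum_eq_add_erase g a, ← add_sum_erase _ g hbm, h0]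
    rw [← add_sum_erase _ _ hbm] at star
    linarith [rest ((univ.erase a).erase b)]
  by_cases hca : f b = a
  · have h0 : g a + g b = 0 := by
      simp only [hg, hca, ← hb, im_conj_mul_swap]
    rw [sum_eq_add_erase g a, ← add_sum_erase _ g hbm]
    rw [← add_sum_erase _ _ hbm] at star
    linarith [rest ((univ.erase a).erase b), nonneg b]
  set c := f b with hc
  have hcm : c ∈ (univ.erase a).erase b := mem_erase.2 ⟨hcb, mem_erase.2 ⟨hca, mem_univ c⟩⟩
  have card3 : (#(((univ.erase a).erase b).erase c) : ℝ) + 1 = #((univ.erase a).erase b) := by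
    exact_mod_cast card_erase_add_one hcm
  have split3 : ∀ φ : Fin d → ℝ, ∑ i, φ i =
      φ a + (φ b + (φ c + ∑ i ∈ ((univ.erase a).erase b).erase c, φ i)) := fun φ => by
    rw [sum_eq_add_erase φ a, ← add_sum_erase _ φ hbm, ← add_sum_erase _ φ hcm]
  have hgb : g b ≤ ‖x b‖ * ‖x c‖ := im_conj_mul_le _ _
  have hgb' : ‖x b‖ * ‖x c‖ ≤ ‖x a‖ * ‖x c‖ :=
    mul_le_mul_of_nonneg_right (ha b) (norm_nonneg _)
  have star3 := star
  rw [← add_sum_erase _ _ hbm, ← add_sum_erase _ _ hcm] at star3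
  by_cases hec : f c = c
  · have h0 : g c = 0 := by simp only [hg, hec, im_conj_mul_self]
    rw [split3 g, h0]
    linarith [rest (((univ.erase a).erase b).erase c)]
  by_cases heb : f c = b
  · have h0 : g b + g c = 0 := by
      simp only [hg, heb, ← hc, im_conj_mul_swap]
    rw [split3 g]
    linarith [rest (((univ.erase a).erase b).erase c), nonneg c]
  have d3 : (3 : ℝ) ≤ d := by
    have : (0 : ℝ) ≤ #(((univ.erase a).erase b).erase c) := Nat.cast_nonneg _
    linarith
  by_cases hea : f c = a
  · have ht := triangle_bound (x a) (x b) (x c) ((d : ℝ) - 3) μ hμ (by linarith)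
      (by have := h3 (by exact_mod_cast d3); linarith)
    have hr := sum_mul_le_card (((univ.erase a).erase b).erase c) (fun i => ‖x i‖) ‖x a‖ μ hμ
    have hcd : (#(((univ.erase a).erase b).erase c) : ℝ) = d - 3 := by linarith
    rw [hcd] at hr
    rw [split3 g, split3 (fun i => ‖x i‖ ^ 2)]
    have e1 : g a = ((starRingEnd ℂ) (x a) * x b).im := rfl
    have e2 : g b = ((starRingEnd ℂ) (x b) * x c).im := rfl
    have e3 : g c = ((starRingEnd ℂ) (x c) * x a).im := by simp only [hg, hea]
    rw [e1, e2, e3]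
    linarith [rest (((univ.erase a).erase b).erase c)]
  set e := f c with he
  have hem : e ∈ ((univ.erase a).erase b).erase c :=
    mem_erase.2 ⟨hec, mem_erase.2 ⟨heb, mem_erase.2 ⟨hea, mem_univ e⟩⟩⟩
  set s := (((univ.erase a).erase b).erase c).erase e with hs
  have card4 : (#s : ℝ) + 1 = #(((univ.erase a).erase b).erase c) := by
    exact_mod_cast card_erase_add_one hem
  have d4 : (4 : ℝ) ≤ d := by
    have : (0 : ℝ) ≤ #s := Nat.cast_nonneg _
    linarith
  have split4 : ∀ φ : Fin d → ℝ, ∑ i, φ i = φ a + (φ b + (φ c + (φ e + ∑ i ∈ s, φ i))) :=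
    fun φ => by rw [split3 φ, ← add_sum_erase _ φ hem]
  -- Wherever `f e` points, `g e ≤ ‖x a‖ * ‖x e‖` closes the 4-cycle.
  have hq := square_bound ‖x a‖ ‖x b‖ ‖x c‖ ‖x e‖ ((d : ℝ) - 4) μ hμ (by linarith)
    (by have := h4 (by exact_mod_cast d4); linarith)
  have hr := sum_mul_le_card s (fun i => ‖x i‖) ‖x a‖ μ hμ
  have hcd : (#s : ℝ) = d - 4 := by linarith
  rw [hcd] at hr
  rw [split4 g, split4 (fun i => ‖x i‖ ^ 2)]
  have hgc : g c ≤ ‖x c‖ * ‖x e‖ := im_conj_mul_le _ _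
  linarith [rest s, hgle e]

lemma IsSubgenerator.im_le {d : ℕ} {Q : Matrix (Fin d) (Fin d) ℝ} (hQ : IsSubgenerator Q)
    {lam : ℝ} (hr : IsUniformizationRate Q lam) (hlam : 0 ≤ lam) (x : Fin d → ℂ)
    (μ : ℝ) (hμ : 0 < μ)
    (h1 : (d : ℝ) - 1 ≤ μ ^ 2) (h3 : 3 ≤ d → 0 ≤ μ ^ 4 - d * μ ^ 2 + (d - 3))
    (h4 : 4 ≤ d → 0 ≤ μ ^ 4 - d * μ ^ 2 + 2 * (d - 4)) :
    ∑ i, ∑ j, Q i j * ((starRingEnd ℂ) (x i) * x j).im ≤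
      lam * (μ / 2) * ∑ i, ‖x i‖ ^ 2 := by
  rcases isEmpty_or_nonempty (Fin d) with h | h
  · simp
  choose f hf using fun i => Finite.exists_max fun j => ((starRingEnd ℂ) (x i) * x j).im
  have hrow : ∀ i, ∑ j, Q i j * ((starRingEnd ℂ) (x i) * x j).im ≤
      lam * ((starRingEnd ℂ) (x i) * x (f i)).im := by
    intro i
    have h0 := im_conj_mul_self (x i)
    have hn : 0 ≤ ((starRingEnd ℂ) (x i) * x (f i)).im := h0 ▸ hf i i
    refine hQ.row_le hr i _ _ hn (fun j => ?_) ?_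
    · rw [h0, sub_zero]
      exact hf i j
    · rw [h0, neg_zero]
      exact hn
  refine (Finset.sum_le_sum fun i _ => hrow i).trans ?_
  rw [← Finset.mul_sum, mul_assoc]
  exact mul_le_mul_of_nonneg_left (functional_im_le x f μ hμ h1 h3 h4) hlam

/-! ### Extremal generators and vectors. -/

/-- The generator with all jump rates `lam` along the functional digraph `i ↦ f i`. -/
def functionalGenerator {d : ℕ} (f : Fin d → Fin d) (lam : ℝ) : Matrix (Fin d) (Fin d) ℝ :=
  fun i j => lam * ((if j = f i then 1 else 0) - (if j = i then 1 else 0))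

lemma functionalGenerator_isGenerator {d : ℕ} (f : Fin d → Fin d) {lam : ℝ} (hlam : 0 ≤ lam) :
    IsGenerator (functionalGenerator f lam) := by
  refine ⟨fun i j hij => ?_, fun i => ?_⟩
  · simp only [functionalGenerator, if_neg hij.symm, sub_zero]
    split_ifs <;> simp [hlam]
  · simp [functionalGenerator, ← Finset.mul_sum]

lemma functionalGenerator_rate {d : ℕ} (f : Fin d → Fin d) {lam : ℝ} (hlam : 0 ≤ lam) :
    IsUniformizationRate (functionalGenerator f lam) lam := by
  intro i
  simp only [functionalGenerator, if_true]
  split_ifs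
  · simpa using hlam
  · simp [abs_of_nonneg hlam]

/-- Rayleigh quotients of functional generators are in their fields of values. -/
lemma functionalGenerator_mem {d : ℕ} (f : Fin d → Fin d) (lam : ℝ) (y : Fin d → ℂ)
    (hy : 0 < ∑ i, ‖y i‖ ^ 2) :
    (lam : ℂ) * (∑ i, (starRingEnd ℂ) (y i) * (y (f i) - y i)) / ((∑ i, ‖y i‖ ^ 2 : ℝ) : ℂ) ∈
      fieldOfValues ((functionalGenerator f lam).map (fun r : ℝ => (r : ℂ))) := by
  set S := ∑ i, ‖y i‖ ^ 2 with hS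
  have hs : 0 < √S := Real.sqrt_pos.2 hy
  have hss : √S ^ 2 = S := Real.sq_sqrt hy.le
  refine ⟨WithLp.toLp 2 fun i => y i / (√S : ℂ), ?_, ?_⟩
  · have h2 : ‖(WithLp.toLp 2 fun i => y i / (√S : ℂ) : EuclideanSpace ℂ (Fin d))‖ ^ 2 = 1 := by
      rw [EuclideanSpace.norm_sq_eq]
      simp only [norm_div, div_pow, ← Finset.sum_div, Complex.norm_real, Real.norm_eq_abs, sq_abs,
        hss, ← hS]
      exact div_self hy.ne'
    exact (pow_eq_one_iff_of_nonneg (norm_nonneg _) two_ne_zero).1 h2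
  · have hc : (S : ℂ) = (√S : ℂ) ^ 2 := by rw [← hss]; push_cast; rw [hss]
    have hsc : (√S : ℂ) ≠ 0 := by exact_mod_cast hs.ne'
    rw [hc, Finset.mul_sum, Finset.sum_div]
    refine Finset.sum_congr rfl fun i _ => ?_
    have e : ∀ j, (starRingEnd ℂ) (y i / (√S : ℂ)) *
        (functionalGenerator f lam).map (fun r : ℝ => (r : ℂ)) i j * (y j / (√S : ℂ)) =
        (if j = f i then (starRingEnd ℂ) (y i) * lam * y j / (√S : ℂ) ^ 2 else 0) -
        (if j = i then (starRingEnd ℂ) (y i) * lam * y j / (√S : ℂ) ^ 2 else 0) := by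
      intro j
      simp only [Matrix.map_apply, functionalGenerator, map_div₀, Complex.conj_ofReal]
      split_ifs <;> (push_cast; field_simp; try ring)
    simp only [e, Finset.sum_sub_distrib, Finset.sum_ite_eq', Finset.mem_univ, if_true]
    ring

lemma exists_re_max (n : ℕ) : ∃ (y : Fin (n + 1) → ℂ) (f : Fin (n + 1) → Fin (n + 1)),
    0 < ∑ i, ‖y i‖ ^ 2 ∧ (∑ i, (starRingEnd ℂ) (y i) * (y (f i) - y i)).re =
      (√((n + 1 : ℕ) : ℝ) - 1) / 2 * ∑ i, ‖y i‖ ^ 2 := by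
  have hss : √((n + 1 : ℕ) : ℝ) ^ 2 = ((n + 1 : ℕ) : ℝ) := Real.sq_sqrt (Nat.cast_nonneg _)
  have hs : 0 ≤ √((n + 1 : ℕ) : ℝ) := Real.sqrt_nonneg _
  set s := √((n + 1 : ℕ) : ℝ)
  have hsn : s ^ 2 = n + 1 := by rw [hss]; push_cast; ring
  have hS : ∑ i, ‖(Fin.cons ((1 + s : ℝ) : ℂ) (fun _ => 1) : Fin (n + 1) → ℂ) i‖ ^ 2 =
      (1 + s) ^ 2 + n := by
    simp only [Fin.sum_univ_succ, Fin.cons_zero, Fin.cons_succ, Complex.norm_real,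
      Real.norm_eq_abs, sq_abs]
    simp
  -- Equality in AM-GM: the centre is `1 + √d` times each leaf.
  refine ⟨Fin.cons ((1 + s : ℝ) : ℂ) fun _ => 1, fun _ => 0, ?_, ?_⟩
  · rw [hS]
    positivity
  · rw [hS]
    simp only [Fin.sum_univ_succ, Fin.cons_zero, Fin.cons_succ]
    simp
    have hn : (n : ℝ) = s ^ 2 - 1 := by linarith
    rw [hn]
    ring

lemma exists_re_min (n : ℕ) : ∃ (y : Fin (n + 2) → ℂ) (f : Fin (n + 2) → Fin (n + 2)),
    0 < ∑ i, ‖y i‖ ^ 2 ∧ (∑ i, (starRingEnd ℂ) (y i) * (y (f i) - y i)).re =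
      -(1 + √(((n + 2 : ℕ) : ℝ) + 2) / 2) * ∑ i, ‖y i‖ ^ 2 := by
  have hss : √(((n + 2 : ℕ) : ℝ) + 2) ^ 2 = ((n + 2 : ℕ) : ℝ) + 2 := Real.sq_sqrt (by positivity)
  set s := √(((n + 2 : ℕ) : ℝ) + 2)
  have hn : (n : ℝ) = s ^ 2 - 4 := by rw [hss]; push_cast; ring
  have hS : ∑ i, ‖(Fin.cons ((-s : ℝ) : ℂ) (Fin.cons ((2 : ℝ) : ℂ) fun _ => 1) :
      Fin (n + 2) → ℂ) i‖ ^ 2 = s ^ 2 + 4 + n := by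
    simp only [Fin.sum_univ_succ, Fin.cons_zero, Fin.cons_succ, Complex.norm_real,
      Real.norm_eq_abs, sq_abs]
    simp
    ring
  -- Equality case of the double star with all pendant vertices attached to `0`.
  refine ⟨Fin.cons ((-s : ℝ) : ℂ) (Fin.cons ((2 : ℝ) : ℂ) fun _ => 1),
    Fin.cons (Fin.succ 0) fun _ => 0, ?_, ?_⟩
  · rw [hS]
    positivity
  · rw [hS]
    simp only [Fin.sum_univ_succ, Fin.cons_zero, Fin.cons_succ]
    simp
    rw [hn]
    ring

lemma exists_im_max (n : ℕ) (μ : ℝ) (hμ : μ ≠ 0)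
    (h : μ ^ 4 - ((n : ℝ) + 3) * μ ^ 2 + n = 0) :
    ∃ (y : Fin (n + 3) → ℂ) (f : Fin (n + 3) → Fin (n + 3)),
      0 < ∑ i, ‖y i‖ ^ 2 ∧ (∑ i, (starRingEnd ℂ) (y i) * (y (f i) - y i)).im =
        μ / 2 * ∑ i, ‖y i‖ ^ 2 := by
  -- Makes every square in `triangle_bound` vanish; each pendant entry is a quarter turn from the
  -- centre, with modulus smaller by the factor `μ`.
  let y : Fin (n + 3) → ℂ := Fin.cons ⟨μ ^ 2 - 1, 0⟩ (Fin.cons ⟨-1, μ⟩ (Fin.cons ⟨-1, -μ⟩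
    fun _ => ⟨0, -(μ ^ 2 - 1) / μ⟩))
  have hS : ∑ i, ‖y i‖ ^ 2 =
      (μ ^ 2 - 1) ^ 2 + 2 * (1 + μ ^ 2) + n * ((μ ^ 2 - 1) / μ) ^ 2 := by
    simp only [← Complex.normSq_eq_norm_sq, Complex.normSq_apply, Fin.sum_univ_succ, y,
      Fin.cons_zero, Fin.cons_succ]
    simp
    ring
  refine ⟨y, Fin.cons (Fin.succ 0) (Fin.cons (Fin.succ (Fin.succ 0)) fun _ => 0), ?_, ?_⟩
  · rw [hS]
    positivity
  · rw [hS]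
    simp only [Fin.sum_univ_succ, y, Fin.cons_zero, Fin.cons_succ]
    simp
    have hn : (n : ℝ) * (μ ^ 2 - 1) = μ ^ 2 * (μ ^ 2 - 3) := by linarith
    field_simp
    linear_combination (μ ^ 2 - 1) * hn

/-! ### Assembly of the least rectangle. -/

/-- The rectangle with the given imaginary half-width is least, provided `μ` dominates the
functional digraphs and its bound is attained. -/
lemma isLeast_rectangle (d : ℕ) (hd : 2 ≤ d) (lam : ℝ) (hlam : 0 ≤ lam) (μ : ℝ) (hμ : 0 < μ)
    (h1 : (d : ℝ) - 1 ≤ μ ^ 2) (h3 : 3 ≤ d → 0 ≤ μ ^ 4 - d * μ ^ 2 + (d - 3))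
    (h4 : 4 ≤ d → 0 ≤ μ ^ 4 - d * μ ^ 2 + 2 * (d - 4))
    (hw : ∃ (y : Fin d → ℂ) (f : Fin d → Fin d),
      0 < ∑ i, ‖y i‖ ^ 2 ∧ (∑ i, (starRingEnd ℂ) (y i) * (y (f i) - y i)).im =
        μ / 2 * ∑ i, ‖y i‖ ^ 2) :
    IsLeast
      {R : Set ℂ | IsAxisRectangle R ∧
        ∀ Q : Matrix (Fin d) (Fin d) ℝ,
          (IsGenerator Q ∨ IsSubgenerator Q) → IsUniformizationRate Q lam →
            fieldOfValues (Q.map (fun r : ℝ => (r : ℂ))) ⊆ R}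
      {z : ℂ | z.re ∈ Set.Icc (-(1 + √((d : ℝ) + 2) / 2) * lam) (lam / 2 * (√(d : ℝ) - 1)) ∧
        z.im ∈ Set.Icc (-(lam * (μ / 2))) (lam * (μ / 2))} := by
  have hd1 : 1 ≤ √(d : ℝ) := Real.one_le_sqrt.2 (by exact_mod_cast (by omega : 1 ≤ d))
  have hL : 0 ≤ (1 + √((d : ℝ) + 2) / 2) * lam := by positivity
  have hU : 0 ≤ lam / 2 * (√(d : ℝ) - 1) := mul_nonneg (by positivity) (by linarith)
  have hV : 0 ≤ lam * (μ / 2) := by positivity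
  refine ⟨⟨⟨_, _, _, _, by linarith, by linarith, rfl⟩, ?_⟩, ?_⟩
  · rintro Q hQ hr z ⟨x, hx, rfl⟩
    replace hQ : IsSubgenerator Q := hQ.elim (·.isSubgenerator) id
    have hx1 : ∑ i, ‖x i‖ ^ 2 = 1 := by
      rw [← EuclideanSpace.norm_sq_eq, hx, one_pow]
    have b1 := hQ.le_re hr hlam x
    have b2 := hQ.re_le hr hlam x
    have b3 := hQ.im_le hr hlam x μ hμ h1 h3 h4
    -- Conjugating `x` flips the sign of the imaginary part.
    have b4 := hQ.im_le hr hlam (fun i => (starRingEnd ℂ) (x i)) μ hμ h1 h3 h4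
    simp only [RCLike.norm_conj] at b4
    rw [hx1, mul_one] at b1 b2 b3 b4
    have e : ∑ i, ∑ j, Q i j * ((starRingEnd ℂ) ((starRingEnd ℂ) (x i)) *
        (starRingEnd ℂ) (x j)).im = -∑ i, ∑ j, Q i j * ((starRingEnd ℂ) (x i) * x j).im := by
      simp only [← map_mul, Complex.conj_im, mul_neg, Finset.sum_neg_distrib]
    rw [e] at b4
    simp only [Set.mem_ofPred_eq, Set.mem_Icc]
    rw [re_form, im_form]
    exact ⟨⟨by linarith, b2⟩, by linarith, b3⟩
  · rintro R ⟨⟨p, q, r, s, -, -, rfl⟩, hR⟩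
    have hmem : ∀ (y : Fin d → ℂ) (f : Fin d → Fin d), 0 < ∑ i, ‖y i‖ ^ 2 → ∀ α β : ℝ,
        (∑ i, (starRingEnd ℂ) (y i) * (y (f i) - y i)).re = α * ∑ i, ‖y i‖ ^ 2 →
        (∑ i, (starRingEnd ℂ) (y i) * (y (f i) - y i)).im = β * ∑ i, ‖y i‖ ^ 2 →
        lam * α ∈ Set.Icc p q ∧ lam * β ∈ Set.Icc r s := by
      intro y f hy α β hα hβ
      have h := hR _ (Or.inl (functionalGenerator_isGenerator f hlam))
        (functionalGenerator_rate f hlam) (functionalGenerator_mem f lam y hy)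
      simpa only [Set.mem_ofPred_eq, Complex.div_ofReal_re, Complex.div_ofReal_im,
        Complex.re_ofReal_mul, Complex.im_ofReal_mul, hα, hβ, ← mul_assoc,
        mul_div_cancel_right₀ _ hy.ne'] using h
    have hmem_re : ∀ (y : Fin d → ℂ) (f : Fin d → Fin d), 0 < ∑ i, ‖y i‖ ^ 2 → ∀ α : ℝ,
        (∑ i, (starRingEnd ℂ) (y i) * (y (f i) - y i)).re = α * ∑ i, ‖y i‖ ^ 2 →
        lam * α ∈ Set.Icc p q := fun y f hy α hα =>
      (hmem y f hy α _ hα (div_mul_cancel₀ _ hy.ne').symm).1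
    have hmem_im : ∀ (y : Fin d → ℂ) (f : Fin d → Fin d), 0 < ∑ i, ‖y i‖ ^ 2 → ∀ β : ℝ,
        (∑ i, (starRingEnd ℂ) (y i) * (y (f i) - y i)).im = β * ∑ i, ‖y i‖ ^ 2 →
        lam * β ∈ Set.Icc r s := fun y f hy β hβ =>
      (hmem y f hy _ β (div_mul_cancel₀ _ hy.ne').symm hβ).2
    obtain ⟨n, rfl⟩ : ∃ n, d = n + 2 := ⟨d - 2, by omega⟩
    obtain ⟨y1, f1, p1, w1⟩ := exists_re_max (n + 1)
    obtain ⟨y2, f2, p2, w2⟩ := exists_re_min n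
    obtain ⟨y3, f3, p3, w3⟩ := hw
    have m1 := hmem_re y1 f1 p1 _ w1
    have m2 := hmem_re y2 f2 p2 _ w2
    have m3 := hmem_im y3 f3 p3 _ w3
    have m4 := hmem_im (fun i => (starRingEnd ℂ) (y3 i)) f3 (by simpa using p3) (-(μ / 2)) (by
      simp only [← map_sub, ← map_mul, ← map_sum, Complex.conj_im, w3, RCLike.norm_conj]
      ring)
    rintro z ⟨⟨z1, z2⟩, z3, z4⟩
    exact ⟨⟨by linarith [m2.1], by linarith [m1.2]⟩, by linarith [m4.1], by linarith [m3.2]⟩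

theorem mainTheorem12 (d : ℕ) (hd : 2 ≤ d) (lam : ℝ) (hlam : 0 ≤ lam) :
    IsLeast
      {R : Set ℂ | IsAxisRectangle R ∧
        ∀ Q : Matrix (Fin d) (Fin d) ℝ,
          (IsGenerator Q ∨ IsSubgenerator Q) → IsUniformizationRate Q lam →
            fieldOfValues (Q.map (fun r : ℝ => (r : ℂ))) ⊆ R}
      (rectangleOmega d lam) := by
  unfold rectangleOmega
  split_ifs with hd2 hd3 hd4
  · subst hd2
    have h4 : √(((2 : ℕ) : ℝ) + 2) = 2 := by
      rw [Real.sqrt_eq_iff_mul_self_eq_of_pos two_pos]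
      norm_num
    have h := isLeast_rectangle 2 le_rfl lam hlam 1 one_pos (by norm_num) (by norm_num)
      (by norm_num) ⟨![1, Complex.I], ![1, 1], by simp, by simp [Fin.sum_univ_two]; norm_num⟩
    rw [h4, show -(1 + 2 / 2) * lam = -2 * lam by ring, mul_comm lam (1 / 2)] at h
    exact_mod_cast h
  · subst hd3
    have h3 : √(3 : ℝ) ^ 2 = 3 := Real.sq_sqrt (by norm_num)
    have h34 : √(3 : ℝ) ^ 4 = 9 := by rw [show 4 = 2 * 2 from rfl, pow_mul, h3]; norm_num
    have h := isLeast_rectangle 3 hd lam hlam (√3) (by positivity) (by rw [h3]; norm_num)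
      (by rw [h3, h34]; norm_num) (by norm_num)
      (exists_im_max 0 (√3) (by positivity) (by rw [h3, h34]; norm_num))
    rw [show ((3 : ℕ) : ℝ) + 2 = 5 by norm_num, mul_comm lam (√3 / 2)] at h
    exact_mod_cast h
  · subst hd4
    have h4 : √((4 : ℕ) : ℝ) = 2 := by
      rw [Real.sqrt_eq_iff_mul_self_eq_of_pos two_pos]
      norm_num
    have h := isLeast_rectangle 4 hd lam hlam 2 two_pos (by norm_num) (by norm_num)
      (by norm_num) ⟨![1, Complex.I, -1, -Complex.I], ![1, 2, 3, 0],
        by simp [Fin.sum_univ_four]; norm_num, by simp [Fin.sum_univ_four]⟩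
    rw [h4, show ((4 : ℕ) : ℝ) + 2 = 6 by norm_num, show lam / 2 * (2 - 1) = lam / 2 by ring,
      show lam * (2 / 2) = lam by ring] at h
    exact h
  · have hd5 : (5 : ℝ) ≤ d := by exact_mod_cast (by omega : 5 ≤ d)
    -- `μ ^ 2` is the larger root of `t ^ 2 - d t + (d - 3)`, the triangle condition; it implies the
    -- 4-cycle condition because `2 (d - 4) ≥ d - 3` for `d ≥ 5`.
    set D := √((d : ℝ) ^ 2 - 4 * d + 12) with hD
    have hDD : D ^ 2 = (d : ℝ) ^ 2 - 4 * d + 12 := Real.sq_sqrt (by nlinarith)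
    have hD2 : (d : ℝ) - 2 ≤ D := Real.le_sqrt_of_sq_le (by nlinarith)
    set μ := √(((d : ℝ) + D) / 2) with hμdef
    have hμ2 : μ ^ 2 = ((d : ℝ) + D) / 2 := Real.sq_sqrt (by linarith)
    have hμ : 0 < μ := Real.sqrt_pos.2 (by linarith)
    have hμ4 : μ ^ 4 - d * μ ^ 2 + (d - 3) = 0 := by
      rw [show 4 = 2 * 2 from rfl, pow_mul, hμ2]
      linear_combination hDD / 4
    have hval : √2 * lam / 4 * √((d : ℝ) + D) = lam * (μ / 2) := by
      have h2 : (d : ℝ) + D = 2 * (((d : ℝ) + D) / 2) := by ring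
      have h22 : √(2 : ℝ) ^ 2 = 2 := Real.sq_sqrt (by norm_num)
      rw [h2, Real.sqrt_mul two_pos.le, ← hμdef]
      linear_combination lam * μ / 4 * h22
    rw [hval]
    refine isLeast_rectangle d hd lam hlam μ hμ (by linarith) (fun _ => hμ4.ge)
      (fun _ => by linarith) ?_
    obtain ⟨n, rfl⟩ : ∃ n, d = n + 3 := ⟨d - 3, by omega⟩
    exact exists_im_max n μ hμ.ne' (by push_cast at hμ4; linarith)
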